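/- **Proposition (Universal approximator).** Let $m\in\mathbb N$ be the number of wind sites and let $\mathbf G=\begin{bmatrix}\mathbf 1_m^\top\\ \mathbf I_{m\times m}\end{bmatrix}\in\mathbb R^{(m+1)\times m}$ be the structure matrix. On a probability space, let $\mathbf X=(X_1,\dots,X_m)$ be the NWP features, where $X_i$ takes values in a standard Borel space $\mathcal X_i$, and let $\mathbf Y=(Y_1,\dots,Y_m)\in\mathbb R^m$ be the site-level generation; the joint law of $(\mathbf X,\mathbf Y)$ is arbitrary. Let the noise $\eta=(\eta_1,\dots,\eta_m)\sim\mathcal N(\mathbf 0,\mathbf I_m)$ be independent of $\mathbf X$. For each $i$ let the base generative model $T_i:\mathbb R\times\mathcal X_i\to\mathbb R$ be Borel measurable and invertible, that is, injective as a function of the pair (noise, features). Let $\tilde y_{\mathrm{sum}}$ be any real random variable (the base forecast of the aggregate), and let the random base forecast be $$\tilde{\mathbf y}=\bigl[\tilde y_{\mathrm{sum}},\,T_1(\eta_1,X_1),\dots,T_m(\eta_m,X_m)\bigr]^\top\in\mathbb R^{m+1}.$$ Let $\sigma:\mathbb R\to\mathbb R$ be a continuous activation function that is not a polynomial, and let $L\ge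 1$. For the parameters $\theta$ (weights and biases) of a fully connected feed-forward neural network $q(\cdot;\theta):\mathbb R^{m+1}\to\mathbb R^m$ with $L$ hidden layers of arbitrary finite widths, with $\sigma$ applied coordinatewise in the hidden layers and an affine output layer, let $T_{\mathrm R}(\mathbf y;\theta)=\mathbf G\,q(\mathbf y;\theta)$ be the reconciliation map. Then $T_{\mathrm R}$ is a universal approximator of the conditional joint distribution $F_{\mathbf Y\mid\mathbf X}$: there is a sequence of parameters $(\theta_n)_{n\in\mathbb N}$ of such networks for which, for almost every $x$ with respect to the law of $\mathbf X$, as $n\to\infty$, 1. the conditional law of $T_{\mathrm R}(\tilde{\mathbf y};\theta_n)$ given $\mathbf X=x$ converges weakly to the conditional law of $\mathbf G\mathbf Y=[\sum_i Y_i,Y_1,\dots,Y_m]^\top$ given $\mathbf X=x$; 2. the conditional law of the last $m$ (site-level) components of $T_{\mathrm R}(\tilde{\mathbf y};\theta_n)$ given $\mathbf X=x$ converges weakly to $F_{\mathbf Y\mid\mathbf X}(\cdot\mid x)$, the conditional law of $\mathbf Y$ given $\mathbf X=x$. -/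

import Mathlib

open MeasureTheory ProbabilityTheory Filter Topology

/-- The structure matrix of the two-level hierarchy with `m` sites: a row of ones (the aggregate)
on top of the `m × m` identity matrix (the sites). -/
def structureMatrix (m : ℕ) : Matrix (Fin (m + 1)) (Fin m) ℝ :=
  Matrix.of fun i j => Fin.cases 1 (fun k => if k = j then 1 else 0) i

/-- The parameters (weights and biases) of a fully connected feed-forward neural network with `L`
hidden layers, of arbitrary widths, with inputs in `ℝ^d` and outputs in `ℝ^k`. -/
inductive NeuralNet : (L d k : ℕ) → Type
  | affine {d k : ℕ} (W : Matrix (Fin k) (Fin d) ℝ) (b : Fin k → ℝ) : NeuralNet 0 d k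
  | layer {L d w k : ℕ} (θ : NeuralNet L d w) (W : Matrix (Fin k) (Fin w) ℝ) (b : Fin k → ℝ) :
      NeuralNet (L + 1) d k

/-- The function computed by a neural network with activation function `σ`: the hidden layers
apply `σ` coordinatewise, the output layer is affine. -/
def NeuralNet.eval (σ : ℝ → ℝ) : {L d k : ℕ} → NeuralNet L d k → (Fin d → ℝ) → (Fin k → ℝ)
  | _, _, _, .affine W b, x => W.mulVec x + b
  | _, _, _, .layer θ W b, x => W.mulVec (fun j => σ (θ.eval σ x j)) + b

/-- The reconciliation map: the network `q(·; θ) : ℝ^(m+1) → ℝ^m`, followed by multiplication by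
the structure matrix. -/
def reconcile (σ : ℝ → ℝ) {L m : ℕ} (θ : NeuralNet L (m + 1) m) (y : Fin (m + 1) → ℝ) :
    Fin (m + 1) → ℝ :=
  (structureMatrix m).mulVec (θ.eval σ y)

/-- The random base forecast `[ỹ_sum, T₁(η₁, X₁), …, T_m(η_m, X_m)]`. -/
def baseForecast {Ω : Type*} {m : ℕ} {𝒳 : Fin m → Type*} (ysum : Ω → ℝ)
    (T : (i : Fin m) → ℝ × 𝒳 i → ℝ) (η : Fin m → Ω → ℝ) (X : (i : Fin m) → Ω → 𝒳 i) (ω : Ω) :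
    Fin (m + 1) → ℝ :=
  Fin.cons (ysum ω) (fun i => T i (η i ω, X i ω))

/-- The (regular) conditional law of `Z` given `X = x`, as a probability measure; the type of
probability measures carries the topology of weak convergence. -/
noncomputable def condLaw {Ω E F : Type*} [MeasurableSpace Ω] [MeasurableSpace E]
    [MeasurableSpace F] [StandardBorelSpace F] [Nonempty F] (μ : Measure Ω) [IsFiniteMeasure μ]
    (Z : Ω → F) (X : Ω → E) (x : E) : ProbabilityMeasure F :=
  ⟨condDistrib Z X μ x, inferInstance⟩

/-! The base forecast loses no information: an injective Borel map between standard Borel spaces has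
a measurable left inverse, so features and noise are measurable functions of the forecast. One
Gaussian coordinate, pushed through its cdf, is a uniform variable independent of the features, and
such a variable suffices to simulate the conditional law of `Y`. Hence some measurable `g` of the
forecast has the conditional law of `Y` given the features
(`exists_measurable_condDistrib_comp_baseForecast_eq`).

Networks converge to `g` almost everywhere for the law of the forecast
(`NeuralNet.exists_seq_tendsto_ae`): ridge functions of a continuous non-polynomial activation are
dense on compacts, and tightness passes from compacts to finite measures. Disintegrating this
convergence over the features gives weak convergence of the conditional laws
(`ae_tendsto_condLaw_comp`), and multiplication by the structure matrix is continuous. -/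

/-! ### Density of ridge functions on compact sets. -/

/-- By the fundamental theorem of calculus `f` is a `C(K, ℝ)`-valued integral of `f'`, so its
difference quotients, which lie in `M`, converge in sup norm and not just pointwise. -/
theorem mem_of_forall_hasDerivAt_eval {K : Type*} [TopologicalSpace K] [CompactSpace K]
    {M : Submodule ℝ C(K, ℝ)} (hM : IsClosed (M : Set C(K, ℝ))) {f f' : ℝ → C(K, ℝ)}
    (hf' : Continuous f') (hd : ∀ w x, HasDerivAt (fun w => f w x) (f' w x) w)
    (hf : ∀ w, f w ∈ M) (w : ℝ) : f' w ∈ M := by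
  have hFTC : ∀ w, f w = f 0 + ∫ t in (0 : ℝ)..w, f' t := by
    intro w
    ext x
    have h1 := (ContinuousMap.evalCLM ℝ x).intervalIntegral_comp_comm
      (hf'.intervalIntegrable (μ := volume) 0 w)
    have h2 := intervalIntegral.integral_eq_sub_of_hasDerivAt (a := 0) (b := w)
      (fun t _ => hd t x) (by
        apply Continuous.intervalIntegrable
        exact (ContinuousMap.evalCLM ℝ x).continuous.comp hf')
    simp only [ContinuousMap.evalCLM_apply] at h1
    rw [ContinuousMap.add_apply, ← h1, h2]
    ring
  have hder : HasDerivAt f (f' w) w := by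
    have : HasDerivAt (fun w => f 0 + ∫ t in (0 : ℝ)..w, f' t) (f' w) w :=
      (intervalIntegral.integral_hasDerivAt_right (hf'.intervalIntegrable 0 w)
        (hf'.stronglyMeasurableAtFilter _ _) hf'.continuousAt).const_add _
    exact this.congr_of_eventuallyEq (Eventually.of_forall hFTC)
  refine hM.mem_of_tendsto (hasDerivAt_iff_tendsto_slope.1 hder) (Eventually.of_forall fun t => ?_)
  exact M.smul_mem _ (M.sub_mem (hf t) (hf w))

/-- Each derivative in the weight `w` brings down one factor `u`. -/
theorem pow_mul_iteratedDeriv_comp_mem {K : Type*} [TopologicalSpace K] [CompactSpace K]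
    {M : Submodule ℝ C(K, ℝ)} (hM : IsClosed (M : Set C(K, ℝ))) (u : C(K, ℝ)) {τ : ℝ → ℝ}
    (hτ : ContDiff ℝ (⊤ : ℕ∞) τ)
    (h : ∀ w b : ℝ, ∀ g : C(K, ℝ), (∀ x, g x = τ (w * u x + b)) → g ∈ M) (k : ℕ) :
    ∀ w b : ℝ, ∀ g : C(K, ℝ), (∀ x, g x = u x ^ k * iteratedDeriv k τ (w * u x + b)) → g ∈ M := by
  induction k with
  | zero => simpa using h
  | succ k ih =>
    intro w b g hg
    have hc : ∀ j, Continuous (iteratedDeriv j τ) := fun j =>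
      hτ.continuous_iteratedDeriv j (by exact_mod_cast le_top)
    have hd : ∀ y, HasDerivAt (iteratedDeriv k τ) (iteratedDeriv (k + 1) τ y) y := by
      intro y
      rw [iteratedDeriv_succ]
      exact ((hτ.differentiable_iteratedDeriv k
        (by exact_mod_cast WithTop.coe_lt_top k)) y).hasDerivAt
    let f : ℝ → C(K, ℝ) := fun w =>
      ⟨fun x => u x ^ k * iteratedDeriv k τ (w * u x + b), by
        have := hc k; fun_prop⟩
    let f' : ℝ → C(K, ℝ) := fun w =>
      ⟨fun x => u x ^ (k + 1) * iteratedDeriv (k + 1) τ (w * u x + b), by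
        have := hc (k + 1); fun_prop⟩
    have hf' : Continuous f' := by
      apply ContinuousMap.continuous_of_continuous_uncurry
      have := hc (k + 1)
      change Continuous fun p : ℝ × K =>
        u p.2 ^ (k + 1) * iteratedDeriv (k + 1) τ (p.1 * u p.2 + b)
      fun_prop
    have key := mem_of_forall_hasDerivAt_eval hM hf' (f := f) (fun w x => ?_)
      (fun w => ih w b _ fun x => rfl) w
    · convert key using 1
      ext x
      exact hg x
    · have h1 : HasDerivAt (fun w => w * u x + b) (u x) w := by
        simpa using ((hasDerivAt_id w).mul_const (u x)).add_const b
      have := ((hd (w * u x + b)).comp w h1).const_mul (u x ^ k)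
      refine this.congr_deriv ?_
      change _ = u x ^ (k + 1) * _
      ring

theorem integral_mem_of_isClosed {α E : Type*} [MeasurableSpace α] {μ : Measure α}
    [NormedAddCommGroup E] [NormedSpace ℝ E] [CompleteSpace E] {M : Submodule ℝ E}
    (hM : IsClosed (M : Set E)) {F : α → E} (hF : Integrable F μ) (hFM : ∀ t, F t ∈ M) :
    ∫ t, F t ∂μ ∈ M := by
  by_contra h
  obtain ⟨ℓ, c, hℓ, hc⟩ := geometric_hahn_banach_closed_point M.convex hM h
  have h0 : ∀ x ∈ M, ℓ x = 0 := by
    intro x hx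
    by_contra hx0
    -- At this multiple of `x` the functional takes the value `c`, against the strict bound.
    have := hℓ _ (M.smul_mem (c / ℓ x) hx)
    simp [hx0] at this
  have hc0 : 0 < c := by simpa using hℓ 0 M.zero_mem
  rw [← ℓ.integral_comp_comm hF] at hc
  simp only [h0 _ (hFM _), integral_zero] at hc
  exact hc0.not_gt hc

/-- The convolution is a `C(K, ℝ)`-valued integral of multiples of translates of `σ`, so mollifying
does not leave `M`. -/
theorem convolution_comp_mem {K : Type*} [TopologicalSpace K] [CompactSpace K]
    {M : Submodule ℝ C(K, ℝ)} (hM : IsClosed (M : Set C(K, ℝ))) (u : C(K, ℝ)) {σ : ℝ → ℝ}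
    (hσ : Continuous σ)
    (h : ∀ w b : ℝ, ∀ g : C(K, ℝ), (∀ x, g x = σ (w * u x + b)) → g ∈ M)
    {φ : ℝ → ℝ} (hφ : Continuous φ) (hφs : HasCompactSupport φ) (w b : ℝ) (g : C(K, ℝ))
    (hg : ∀ x, g x = convolution φ σ (ContinuousLinearMap.lsmul ℝ ℝ) volume (w * u x + b)) :
    g ∈ M := by
  let F : ℝ → C(K, ℝ) := fun t => ⟨fun x => φ t * σ (w * u x + (b - t)), by fun_prop⟩
  have hF : Continuous F := by
    apply ContinuousMap.continuous_of_continuous_uncurry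
    change Continuous fun p : ℝ × K => φ p.1 * σ (w * u p.2 + (b - p.1))
    fun_prop
  have hFM : ∀ t, F t ∈ M := by
    intro t
    have := M.smul_mem (φ t) (h w (b - t) ⟨fun x => σ (w * u x + (b - t)), by fun_prop⟩
      fun x => rfl)
    exact this
  have hFs : HasCompactSupport F := by
    refine hφs.mono fun t ht => ?_
    contrapose! ht
    simp only [Function.mem_support, not_not] at ht ⊢
    ext x
    simp [F, ht]
  have h2 : g = ∫ t, F t := by
    ext x
    have := (ContinuousMap.evalCLM ℝ x).integral_comp_comm
      (hF.integrable_of_hasCompactSupport hFs (μ := volume))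
    simp only [ContinuousMap.evalCLM_apply] at this
    rw [← this, hg, convolution]
    refine integral_congr_ae (Eventually.of_forall fun t => ?_)
    simp only [F, ContinuousMap.coe_mk, ContinuousLinearMap.lsmul_apply, smul_eq_mul]
    congr 2
    ring
  rw [h2]
  exact integral_mem_of_isClosed hM (hF.integrable_of_hasCompactSupport hFs) hFM

theorem exists_eq_eval_of_iteratedDeriv_eq_zero (k : ℕ) : ∀ {f : ℝ → ℝ},
    ContDiff ℝ (⊤ : ℕ∞) f → (∀ x, iteratedDeriv k f x = 0) →
    ∃ p : Polynomial ℝ, p.degree < k ∧ ∀ x, f x = p.eval x := by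
  induction k with
  | zero =>
    intro f _ h
    exact ⟨0, by simp, fun x => by simpa using h x⟩
  | succ k ih =>
    intro f hf h
    obtain ⟨p, hp, hpf⟩ := ih (f := deriv f) ((contDiff_infty_iff_deriv.1 hf).2)
      (fun x => by rw [← iteratedDeriv_succ']; exact h x)
    let q : Polynomial ℝ := ∑ i ∈ Finset.range k,
      Polynomial.monomial (i + 1) (p.coeff i / (i + 1))
    have hq : q.derivative = p := by
      rcases eq_or_ne p 0 with rfl | h0
      · simp [q]
      rw [Polynomial.derivative_sum]
      conv_rhs => rw [p.as_sum_range' k ((Polynomial.natDegree_lt_iff_degree_lt h0).2 hp)]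
      refine Finset.sum_congr rfl fun i _ => ?_
      rw [Polynomial.derivative_monomial]
      congr 1
      push_cast
      field_simp
    have hconst : ∀ x, f x - q.eval x = f 0 - q.eval 0 := by
      intro x
      refine is_const_of_deriv_eq_zero (f := fun x => f x - q.eval x)
        ((hf.differentiable (by simp)).sub q.differentiable) (fun y => ?_) x 0
      rw [deriv_fun_sub (hf.differentiable (by simp)).differentiableAt q.differentiableAt,
        Polynomial.deriv, hq, hpf, sub_self]
    refine ⟨q + Polynomial.C (f 0 - q.eval 0), ?_, fun x => ?_⟩
    · refine (Polynomial.degree_add_le _ _).trans_lt (max_lt ?_ ?_)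
      · refine (Polynomial.degree_sum_le _ _).trans_lt ?_
        rw [Finset.sup_lt_iff (by simp)]
        intro i hi
        refine (Polynomial.degree_monomial_le _ _).trans_lt ?_
        simp only [Finset.mem_range] at hi
        exact_mod_cast Nat.succ_lt_succ hi
      · exact Polynomial.degree_C_le.trans_lt (by exact_mod_cast Nat.succ_pos k)
    · simp only [Polynomial.eval_add, Polynomial.eval_C]
      linarith [hconst x]

/-- With the degree bounded, Lagrange interpolation expresses each polynomial through its values at
`k` fixed nodes, where the limit can be taken. -/
theorem exists_eq_eval_of_tendsto_eval {ι : Type*} {l : Filter ι} [l.NeBot] {k : ℕ}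
    {p : ι → Polynomial ℝ} (hp : ∀ i, (p i).degree < k) {f : ℝ → ℝ}
    (h : ∀ x, Tendsto (fun i => (p i).eval x) l (𝓝 (f x))) :
    ∃ q : Polynomial ℝ, ∀ x, f x = q.eval x := by
  have hinj : Set.InjOn (fun n : ℕ => (n : ℝ)) (Finset.range k : Set ℕ) :=
    Nat.cast_injective.injOn
  refine ⟨Lagrange.interpolate (Finset.range k) (fun n : ℕ => (n : ℝ)) (fun n => f n),
    fun x => tendsto_nhds_unique (h x) ?_⟩
  have hpi : ∀ i, (p i).eval x = ∑ n ∈ Finset.range k, (p i).eval (n : ℝ) *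
      (Lagrange.basis (Finset.range k) (fun n : ℕ => (n : ℝ)) n).eval x := by
    intro i
    conv_lhs => rw [Lagrange.eq_interpolate hinj (f := p i) (by simpa using hp i)]
    simp [Lagrange.interpolate_apply, Polynomial.eval_finsetSum]
  simp only [Lagrange.interpolate_apply, Polynomial.eval_finsetSum, Polynomial.eval_mul,
    Polynomial.eval_C]
  refine Tendsto.congr (fun i => (hpi i).symm) ?_
  exact tendsto_finsetSum _ fun n _ => (h n).mul_const _

/-- If `u ^ k` were missing, every mollification of `σ` would have zero `k`-th derivative, hence be
a polynomial of degree below `k`; the degree bound is uniform, so the limit `σ` would be a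
polynomial. -/
theorem pow_mem_of_not_polynomial {K : Type*} [TopologicalSpace K] [CompactSpace K]
    {M : Submodule ℝ C(K, ℝ)} (hM : IsClosed (M : Set C(K, ℝ))) (u : C(K, ℝ)) {σ : ℝ → ℝ}
    (hσ : Continuous σ) (hσpoly : ¬ ∃ p : Polynomial ℝ, ∀ x, σ x = p.eval x)
    (h : ∀ w b : ℝ, ∀ g : C(K, ℝ), (∀ x, g x = σ (w * u x + b)) → g ∈ M) (k : ℕ) :
    u ^ k ∈ M := by
  by_contra hk
  apply hσpoly
  let φ : ℕ → ContDiffBump (0 : ℝ) := fun n =>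
    ⟨1 / (n + 1 : ℝ) / 2, 1 / (n + 1 : ℝ), by positivity, half_lt_self (by positivity)⟩
  let τ : ℕ → ℝ → ℝ := fun n =>
    convolution ((φ n).normed volume) σ (ContinuousLinearMap.lsmul ℝ ℝ) volume
  have hτ : ∀ n, ContDiff ℝ (⊤ : ℕ∞) (τ n) := fun n =>
    (φ n).hasCompactSupport_normed.contDiff_convolution_left _ (φ n).contDiff_normed
      hσ.locallyIntegrable
  have hτ0 : ∀ n b, iteratedDeriv k (τ n) b = 0 := by
    intro n b
    by_contra hb
    -- At weight `0` the derivative factor is constant, leaving a multiple of `u ^ k`.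
    have := pow_mul_iteratedDeriv_comp_mem hM u (hτ n)
      (convolution_comp_mem hM u hσ h (φ n).continuous_normed (φ n).hasCompactSupport_normed) k
      0 b (iteratedDeriv k (τ n) b • u ^ k) (fun x => by simp [mul_comm])
    exact hk ((M.smul_mem_iff hb).1 this)
  choose p hp hpe using fun n => exists_eq_eval_of_iteratedDeriv_eq_zero k (hτ n) (hτ0 n)
  refine exists_eq_eval_of_tendsto_eval (l := atTop) hp fun x => ?_
  simp_rw [← hpe]
  exact ContDiffBump.convolution_tendsto_right_of_continuous (φ := φ)
    tendsto_one_div_add_atTop_nhds_zero_nat hσ x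

theorem exp_mem_of_pow_mem {K : Type*} [TopologicalSpace K] [CompactSpace K]
    {M : Submodule ℝ C(K, ℝ)} (hM : IsClosed (M : Set C(K, ℝ))) (u : C(K, ℝ))
    (h : ∀ k : ℕ, u ^ k ∈ M) : (⟨fun x => Real.exp (u x), by fun_prop⟩ : C(K, ℝ)) ∈ M := by
  have hs : HasSum (fun n : ℕ => ((n.factorial : ℝ)⁻¹) • u ^ n) (NormedSpace.exp u) :=
    NormedSpace.exp_series_hasSum_exp' (𝕂 := ℝ) u
  have he : (⟨fun x => Real.exp (u x), by fun_prop⟩ : C(K, ℝ)) = NormedSpace.exp u := by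
    ext x
    have h1 := hs.map (ContinuousMap.evalCLM ℝ x) (ContinuousMap.evalCLM ℝ x).continuous
    have h2 : HasSum (fun n : ℕ => ((n.factorial : ℝ)⁻¹) • (u x) ^ n) (Real.exp (u x)) := by
      rw [Real.exp_eq_exp_ℝ]
      exact NormedSpace.exp_series_hasSum_exp' (𝕂 := ℝ) (u x)
    exact h2.unique h1
  rw [he]
  exact hM.mem_of_tendsto hs (Eventually.of_forall fun s =>
    M.sum_mem fun n _ => M.smul_mem _ (h n))

/-- The ridge function `x ↦ σ (a ⬝ᵥ x + b)`, for `p = (a, b)`, as a continuous function on `K`. -/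
def ridgeFunction {d : ℕ} {σ : ℝ → ℝ} (hσ : Continuous σ) (K : Set (Fin d → ℝ))
    (p : (Fin d → ℝ) × ℝ) : C(K, ℝ) :=
  ⟨fun x => σ (p.1 ⬝ᵥ (x : Fin d → ℝ) + p.2),
    hσ.comp ((continuous_const.dotProduct continuous_subtype_val).add continuous_const)⟩

/-- Exponentials of linear forms lie in the closed span and are stable under products, so their span
is a point-separating algebra and Stone–Weierstrass applies. -/
theorem ridge_span_dense {d : ℕ} {σ : ℝ → ℝ} (hσ : Continuous σ)
    (hσpoly : ¬ ∃ p : Polynomial ℝ, ∀ x, σ x = p.eval x) (K : Set (Fin d → ℝ))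
    [CompactSpace K] :
    (Submodule.span ℝ (Set.range (ridgeFunction hσ K))).topologicalClosure = ⊤ := by
  set M := (Submodule.span ℝ (Set.range (ridgeFunction hσ K))).topologicalClosure
    with hMdef
  have hM : IsClosed (M : Set C(K, ℝ)) := Submodule.isClosed_topologicalClosure _
  let u : (Fin d → ℝ) → C(K, ℝ) := fun a => 
    ⟨fun x => a ⬝ᵥ (x : Fin d → ℝ), continuous_const.dotProduct continuous_subtype_val⟩
  let e : (Fin d → ℝ) → C(K, ℝ) := fun a => ⟨fun x => Real.exp (u a x), by fun_prop⟩
  have he : ∀ a, e a ∈ M := by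
    intro a
    refine exp_mem_of_pow_mem hM (u a) (pow_mem_of_not_polynomial hM (u a) hσ hσpoly ?_)
    intro w b g hg
    refine Submodule.le_topologicalClosure _ (Submodule.subset_span ⟨(w • a, b), ?_⟩)
    ext x
    simp [hg, u, ridgeFunction]
  let S : Submonoid C(K, ℝ) :=
    { carrier := Set.range e
      one_mem' := ⟨0, by ext x; simp [e, u]⟩
      mul_mem' := by
        rintro _ _ ⟨a, rfl⟩ ⟨b, rfl⟩
        exact ⟨a + b, by ext x; simp [e, u, add_dotProduct, Real.exp_add]⟩ }
  have hSM : ((Algebra.adjoin ℝ (S : Set C(K, ℝ))).topologicalClosure : Set C(K, ℝ)) ⊆ M := by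
    refine closure_minimal ?_ hM
    intro f hf
    have hf : f ∈ Subalgebra.toSubmodule (Algebra.adjoin ℝ (S : Set C(K, ℝ))) := hf
    rw [Algebra.adjoin_eq_span, Submonoid.closure_eq] at hf
    refine Submodule.span_le.2 ?_ hf
    rintro _ ⟨a, rfl⟩
    exact he a
  rw [ContinuousMap.subalgebra_topologicalClosure_eq_top_of_separatesPoints] at hSM
  · exact top_unique fun f _ => hSM trivial
  · intro x y hxy
    have : ∃ i, (x : Fin d → ℝ) i ≠ (y : Fin d → ℝ) i := by
      by_contra! h
      exact hxy (Subtype.ext (funext h))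
    obtain ⟨i, hi⟩ := this
    refine ⟨_, ⟨e (Pi.single i 1), Algebra.subset_adjoin ⟨_, rfl⟩, rfl⟩, ?_⟩
    simpa [e, u] using hi

/-! ### Approximation of continuous functions by networks. -/

theorem NeuralNet.continuous_eval {σ : ℝ → ℝ} (hσ : Continuous σ) {L d k : ℕ}
    (θ : NeuralNet L d k) : Continuous (θ.eval σ) := by
  induction θ with
  | affine W b =>
    change Continuous fun x => W.mulVec x + b
    fun_prop
  | layer θ W b ih =>
    change Continuous fun x => W.mulVec (fun j => σ (θ.eval σ x j)) + b
    fun_prop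

theorem NeuralNet.exists_eval_eq_affine_comp (σ : ℝ → ℝ) {L d k l : ℕ} (θ : NeuralNet L d k)
    (W : Matrix (Fin l) (Fin k) ℝ) (b : Fin l → ℝ) :
    ∃ θ' : NeuralNet L d l, ∀ x, θ'.eval σ x = W.mulVec (θ.eval σ x) + b := by
  cases θ with
  | affine W' b' =>
    exact ⟨.affine (W * W') (W.mulVec b' + b), fun x => by
      simp [NeuralNet.eval, Matrix.mulVec_add, Matrix.mulVec_mulVec, add_assoc]⟩
  | layer θ W' b' =>
    exact ⟨.layer θ (W * W') (W.mulVec b' + b), fun x => by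
      simp [NeuralNet.eval, Matrix.mulVec_add, Matrix.mulVec_mulVec, add_assoc]⟩

/-- Density of networks with one hidden layer, in terms of the weights. -/
theorem exists_shallow_approx {σ : ℝ → ℝ} (hσ : Continuous σ)
    (hσpoly : ¬ ∃ p : Polynomial ℝ, ∀ x, σ x = p.eval x) {d k : ℕ} {K : Set (Fin d → ℝ)}
    (hK : IsCompact K) {f : (Fin d → ℝ) → (Fin k → ℝ)} (hf : Continuous f) {ε : ℝ} (hε : 0 < ε) :
    ∃ (w : ℕ) (A : Matrix (Fin w) (Fin d) ℝ) (b : Fin w → ℝ) (W : Matrix (Fin k) (Fin w) ℝ),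
      ∀ x ∈ K, dist (W.mulVec fun j => σ ((A.mulVec x + b) j)) (f x) < ε := by
  classical
  have : CompactSpace K := isCompact_iff_compactSpace.1 hK
  have h1 : ∀ i, ∃ c : ((Fin d → ℝ) × ℝ) →₀ ℝ, ∀ x ∈ K,
      |(c.sum fun p r => r * σ (p.1 ⬝ᵥ x + p.2)) - f x i| < ε := by
    intro i
    let F : C(K, ℝ) := ⟨fun x => f x i, by fun_prop⟩
    have hF : F ∈ (Submodule.span ℝ (Set.range (ridgeFunction hσ K))).topologicalClosure := by
      rw [ridge_span_dense hσ hσpoly K]; trivial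
    obtain ⟨g, hg, hgF⟩ := Metric.mem_closure_iff.1 hF ε hε
    obtain ⟨c, rfl⟩ := Finsupp.mem_span_range_iff_exists_finsupp.1 hg
    refine ⟨c, fun x hx => ?_⟩
    have := (ContinuousMap.dist_apply_le_dist (f := F) ⟨x, hx⟩).trans_lt hgF
    rw [dist_comm, Real.dist_eq] at this
    have he : (c.sum fun p r => r * σ (p.1 ⬝ᵥ x + p.2))
        = (c.sum fun p r => r • ridgeFunction hσ K p) ⟨x, hx⟩ := by
      simp only [Finsupp.sum, ContinuousMap.sum_apply, ContinuousMap.smul_apply, smul_eq_mul]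
      rfl
    rw [he]
    exact this
  choose c hc using h1
  -- All output coordinates share these hidden units; a unit that a coordinate does not need gets
  -- weight `0`.
  let s : Finset ((Fin d → ℝ) × ℝ) := Finset.univ.biUnion fun i => (c i).support
  let e := s.equivFin
  refine ⟨s.card, Matrix.of fun j => (e.symm j).1.1, fun j => (e.symm j).1.2,
    Matrix.of fun i j => c i (e.symm j).1, fun x hx => ?_⟩
  rw [dist_pi_lt_iff hε]
  intro i
  rw [Real.dist_eq]
  convert hc i x hx using 3
  rw [Finsupp.sum_of_support_subset (s := s) _
    (Finset.subset_biUnion_of_mem (fun i => (c i).support) (Finset.mem_univ i)) _ (by simp)]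
  rw [← Finset.sum_coe_sort s, ← e.symm.sum_comp]
  rfl

/-- **Universal approximation theorem**: networks with at least one hidden layer and a continuous
non-polynomial activation function are dense, uniformly on compact sets. -/
theorem NeuralNet.exists_approx {σ : ℝ → ℝ} (hσ : Continuous σ)
    (hσpoly : ¬ ∃ p : Polynomial ℝ, ∀ x, σ x = p.eval x) {L : ℕ} (hL : 1 ≤ L) {d k : ℕ}
    {K : Set (Fin d → ℝ)} (hK : IsCompact K) {f : (Fin d → ℝ) → (Fin k → ℝ)} (hf : Continuous f)
    {ε : ℝ} (hε : 0 < ε) :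
    ∃ θ : NeuralNet L d k, ∀ x ∈ K, dist (θ.eval σ x) (f x) < ε := by
  induction L, hL using Nat.le_induction generalizing ε with
  | base =>
    obtain ⟨w, A, b, W, h⟩ := exists_shallow_approx hσ hσpoly hK hf hε
    exact ⟨.layer (.affine A b) W 0, fun x hx => by simpa [NeuralNet.eval] using h x hx⟩
  | succ L _ ih =>
    obtain ⟨θ, hθ⟩ := ih (half_pos hε)
    -- The extra layer approximates the identity on the compact image of the shallower network,
    -- whose output layer absorbs the inner affine map.
    obtain ⟨w, A, b, W, h⟩ := exists_shallow_approx hσ hσpoly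
      (hK.image (θ.continuous_eval hσ)) continuous_id (half_pos hε)
    obtain ⟨θ', hθ'⟩ := θ.exists_eval_eq_affine_comp σ A b
    refine ⟨.layer θ' W 0, fun x hx => ?_⟩
    have h1 := h _ ⟨x, hx, rfl⟩
    have h2 := hθ x hx
    refine (dist_triangle _ (θ.eval σ x) _).trans_lt ?_
    have h3 : (NeuralNet.layer θ' W 0).eval σ x
        = W.mulVec fun j => σ ((A.mulVec (θ.eval σ x) + b) j) := by
      simp [NeuralNet.eval, hθ']
    rw [h3]
    simp only [id] at h1
    linarith

/-! ### Approximation of measurable functions. -/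

theorem exists_isCompact_measure_compl_le_ofReal {E : Type*} [MeasurableSpace E]
    [TopologicalSpace E] [PolishSpace E] [BorelSpace E] (Q : Measure E) [IsFiniteMeasure Q] {δ : ℝ}
    (hδ : 0 < δ) : ∃ K : Set E, IsCompact K ∧ Q Kᶜ ≤ ENNReal.ofReal δ := by
  let := TopologicalSpace.upgradeIsCompletelyMetrizable E
  have h : IsTightMeasureSet {Q} := isTightMeasureSet_singleton
  rw [isTightMeasureSet_iff_exists_isCompact_measure_compl_le] at h
  obtain ⟨K, hK, hKQ⟩ := h (ENNReal.ofReal δ) (by simpa using hδ)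
  exact ⟨K, hK, hKQ Q rfl⟩

/-- Tightness of the law of `g` allows truncation to a bounded function, which is approximated in L¹
by continuous functions; Markov's inequality concludes. -/
theorem exists_continuous_measure_dist_ge_le {d k : ℕ} (Q : Measure (Fin d → ℝ))
    [IsFiniteMeasure Q] {g : (Fin d → ℝ) → (Fin k → ℝ)} (hg : Measurable g) {δ : ℝ} (hδ : 0 < δ) :
    ∃ f : (Fin d → ℝ) → (Fin k → ℝ), Continuous f ∧
      Q {x | δ ≤ dist (f x) (g x)} ≤ ENNReal.ofReal δ := by
  obtain ⟨K, hK, hKQ⟩ := exists_isCompact_measure_compl_le_ofReal (Q.map g) (half_pos hδ)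
  rw [Measure.map_apply hg hK.measurableSet.compl] at hKQ
  let g' := (g ⁻¹' K).indicator g
  have hS : MeasurableSet (g ⁻¹' K) := hg hK.measurableSet
  have hg' : Measurable g' := hg.indicator hS
  obtain ⟨C, hC⟩ := hK.isBounded.exists_norm_le
  have hint : Integrable g' Q := by
    refine Integrable.of_bound hg'.aestronglyMeasurable (max C 0) (Eventually.of_forall fun x => ?_)
    by_cases hx : x ∈ g ⁻¹' K
    · simp only [g', Set.indicator_of_mem hx]
      exact (hC _ hx).trans (le_max_left _ _)
    · simp [g', Set.indicator_of_notMem hx]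
  -- With this L¹ error, Markov's inequality at level `δ` leaves measure at most `δ / 2`.
  have hη : ENNReal.ofReal δ * ENNReal.ofReal (δ / 2) ≠ 0 := by
    simp [hδ]
  obtain ⟨f, hf, -⟩ := hint.exists_boundedContinuous_lintegral_sub_le hη
  refine ⟨f, f.continuous, ?_⟩
  have hmark : Q {x | ENNReal.ofReal δ ≤ ‖g' x - f x‖ₑ} ≤ ENNReal.ofReal (δ / 2) := by
    have := (mul_meas_ge_le_lintegral₀ (μ := Q) (f := fun x => ‖g' x - f x‖ₑ)
      (by have := f.continuous.measurable; fun_prop) (ENNReal.ofReal δ)).trans hf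
    exact (ENNReal.mul_le_mul_iff_right (by simpa using hδ) ENNReal.ofReal_ne_top).1 this
  calc Q {x | δ ≤ dist (f x) (g x)}
      ≤ Q ({x | ENNReal.ofReal δ ≤ ‖g' x - f x‖ₑ} ∪ g ⁻¹' Kᶜ) := by
        refine measure_mono fun x hx => ?_
        by_cases hxK : x ∈ g ⁻¹' K
        · left
          simp only [Set.mem_ofPred_eq, g', Set.indicator_of_mem hxK] at hx ⊢
          rw [← ofReal_norm, ← dist_eq_norm, dist_comm]
          exact ENNReal.ofReal_le_ofReal hx
        · exact Or.inr hxK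
    _ ≤ ENNReal.ofReal (δ / 2) + ENNReal.ofReal (δ / 2) :=
        (measure_union_le _ _).trans (add_le_add hmark hKQ)
    _ = ENNReal.ofReal δ := by
        rw [← ENNReal.ofReal_add (by positivity) (by positivity), add_halves]

theorem NeuralNet.exists_measure_dist_ge_le {σ : ℝ → ℝ} (hσ : Continuous σ)
    (hσpoly : ¬ ∃ p : Polynomial ℝ, ∀ x, σ x = p.eval x) {L : ℕ} (hL : 1 ≤ L) {d k : ℕ}
    (Q : Measure (Fin d → ℝ)) [IsFiniteMeasure Q] {g : (Fin d → ℝ) → (Fin k → ℝ)}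
    (hg : Measurable g) {δ : ℝ} (hδ : 0 < δ) :
    ∃ θ : NeuralNet L d k, Q {x | δ ≤ dist (θ.eval σ x) (g x)} ≤ ENNReal.ofReal δ := by
  obtain ⟨f, hf, hfg⟩ := exists_continuous_measure_dist_ge_le Q hg (half_pos hδ)
  obtain ⟨K, hK, hKQ⟩ := exists_isCompact_measure_compl_le_ofReal Q (half_pos hδ)
  obtain ⟨θ, hθ⟩ := NeuralNet.exists_approx hσ hσpoly hL hK hf (half_pos hδ)
  refine ⟨θ, ?_⟩
  calc Q {x | δ ≤ dist (θ.eval σ x) (g x)}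
      ≤ Q ({x | δ / 2 ≤ dist (f x) (g x)} ∪ Kᶜ) := by
        refine measure_mono fun x hx => ?_
        by_cases hxK : x ∈ K
        · left
          have h1 := hθ x hxK
          have h2 := dist_triangle (θ.eval σ x) (f x) (g x)
          simp only [Set.mem_ofPred_eq] at hx ⊢
          linarith
        · exact Or.inr hxK
    _ ≤ ENNReal.ofReal (δ / 2) + ENNReal.ofReal (δ / 2) :=
        (measure_union_le _ _).trans (add_le_add hfg hKQ)
    _ = ENNReal.ofReal δ := by
        rw [← ENNReal.ofReal_add (by positivity) (by positivity), add_halves]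

/-- Every measurable function is an almost everywhere limit of neural networks. -/
theorem NeuralNet.exists_seq_tendsto_ae {σ : ℝ → ℝ} (hσ : Continuous σ)
    (hσpoly : ¬ ∃ p : Polynomial ℝ, ∀ x, σ x = p.eval x) {L : ℕ} (hL : 1 ≤ L) {d k : ℕ}
    (Q : Measure (Fin d → ℝ)) [IsFiniteMeasure Q] {g : (Fin d → ℝ) → (Fin k → ℝ)}
    (hg : Measurable g) :
    ∃ θ : ℕ → NeuralNet L d k, ∀ᵐ x ∂Q, Tendsto (fun n => (θ n).eval σ x) atTop (𝓝 (g x)) := by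
  choose θ hθ using fun n : ℕ =>
    NeuralNet.exists_measure_dist_ge_le hσ hσpoly hL Q hg (Nat.one_div_pos_of_nat (α := ℝ) (n := n))
  have hlim : Tendsto (fun n : ℕ => 1 / ((n : ℝ) + 1)) atTop (𝓝 0) :=
    tendsto_one_div_add_atTop_nhds_zero_nat
  have hmeas : TendstoInMeasure Q (fun n => (θ n).eval σ) atTop g := by
    rw [tendstoInMeasure_iff_dist]
    intro ε hε
    have h0 : Tendsto (fun n : ℕ => ENNReal.ofReal (1 / ((n : ℝ) + 1))) atTop (𝓝 0) := by
      simpa using ENNReal.tendsto_ofReal hlim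
    refine tendsto_of_tendsto_of_tendsto_of_le_of_le' tendsto_const_nhds h0
      (Eventually.of_forall fun _ => zero_le) ?_
    filter_upwards [hlim.eventually_le_const hε] with n hn
    exact (measure_mono fun x hx => hn.trans hx).trans (hθ n)
  obtain ⟨ns, -, hns⟩ := hmeas.exists_seq_tendsto_ae
  exact ⟨fun n => θ (ns n), hns⟩

/-! ### Simulation and convergence of conditional laws. -/

theorem continuous_cdf (ν : Measure ℝ) [IsProbabilityMeasure ν] [NullSingletonClass ν] :
    Continuous (cdf ν) := by
  rw [continuous_iff_continuousAt]
  intro x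
  rw [(monotone_cdf ν).continuousAt_iff_leftLim_eq_rightLim, StieltjesFunction.rightLim_eq]
  have h := (cdf ν).measure_singleton x
  rw [measure_cdf, measure_singleton, eq_comm, ENNReal.ofReal_eq_zero] at h
  exact le_antisymm ((monotone_cdf ν).leftLim_le le_rfl) (by linarith)

theorem exists_cdf_eq (ν : Measure ℝ) [IsProbabilityMeasure ν] [NullSingletonClass ν] {v : ℝ}
    (h0 : 0 < v) (h1 : v < 1) : ∃ x, cdf ν x = v := by
  obtain ⟨a, ha⟩ := ((tendsto_cdf_atBot ν).eventually_lt_const h0).exists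
  obtain ⟨b, hb⟩ := ((tendsto_cdf_atTop ν).eventually_const_lt h1).exists
  exact mem_range_of_exists_le_of_exists_ge (continuous_cdf ν) ⟨a, ha.le⟩ ⟨b, hb.le⟩

/-- The probability integral transform. -/
theorem exists_measurable_map_eq_volume_unitInterval (ν : Measure ℝ) [IsProbabilityMeasure ν]
    [NullSingletonClass ν] : ∃ φ : ℝ → unitInterval, Measurable φ ∧ ν.map φ = volume := by
  have hm : Measurable fun x => (⟨cdf ν x, cdf_nonneg ν x, cdf_le_one ν x⟩ : unitInterval) :=
    (monotone_cdf ν).measurable.subtype_mk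
  refine ⟨_, hm, ?_⟩
  have : IsProbabilityMeasure (ν.map fun x =>
      (⟨cdf ν x, cdf_nonneg ν x, cdf_le_one ν x⟩ : unitInterval)) :=
    Measure.isProbabilityMeasure_map hm.aemeasurable
  refine Measure.ext_of_Iic _ _ fun u => ?_
  rw [Measure.map_apply hm measurableSet_Iic, unitInterval.volume_Iic]
  change ν {x | cdf ν x ≤ u} = _
  rw [← ofReal_measureReal]
  congr 1
  apply le_antisymm
  -- Values `v` strictly above `u` and below `1` are attained by the cdf, which avoids choosing an
  -- endpoint of a plateau.
  · refine le_of_forall_gt_imp_ge_of_dense fun v hv => ?_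
    rcases le_or_gt 1 v with h1 | h1
    · exact measureReal_le_one.trans h1
    · obtain ⟨x, rfl⟩ := exists_cdf_eq ν (u.2.1.trans_lt hv) h1
      rw [cdf_eq_real]
      refine measureReal_mono fun y hy => ?_
      by_contra hxy
      exact absurd (monotone_cdf ν (not_le.1 hxy).le) (not_le.2 (lt_of_le_of_lt hy hv))
  · rcases u.2.1.eq_or_lt with h0 | h0
    · rw [← h0]; exact measureReal_nonneg
    rcases u.2.2.eq_or_lt with h1 | h1
    · rw [h1]
      simp [cdf_le_one]
    · obtain ⟨x, hx⟩ := exists_cdf_eq ν h0 h1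
      rw [← hx, cdf_eq_real]
      refine measureReal_mono fun y hy => ?_
      rw [Set.mem_ofPred_eq, ← cdf_eq_real]
      exact monotone_cdf ν hy

/-- Conditional laws can be simulated from the conditioning variable and independent uniform
noise. -/
theorem exists_measurable_condDistrib_eq {Ω E F : Type*} [MeasurableSpace Ω] [MeasurableSpace E]
    [MeasurableSpace F] [StandardBorelSpace F] [Nonempty F] {μ : Measure Ω} [IsProbabilityMeasure μ]
    {X : Ω → E} (hX : Measurable X) (Y : Ω → F) {U : Ω → unitInterval} (hU : Measurable U)
    (hUlaw : μ.map U = volume) (hXU : IndepFun X U μ) :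
    ∃ f : E × unitInterval → F, Measurable f ∧
      condDistrib (fun ω => f (X ω, U ω)) X μ =ᵐ[μ.map X] condDistrib Y X μ := by
  -- A Markov kernel into a standard Borel space is the law of `f x U` with `U` uniform;
  -- independence then makes the joint law of `X` and `f X U` the composition-product.
  obtain ⟨f, hf, hfκ⟩ := Kernel.exists_measurable_map_eq_unitInterval (condDistrib Y X μ)
  refine ⟨Function.uncurry f, hf,
    condDistrib_ae_eq_of_measure_eq_compProd X (hf.comp (hX.prodMk hU)).aemeasurable ?_⟩
  have hg : Measurable fun p : E × unitInterval => (p.1, Function.uncurry f p) :=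
    measurable_fst.prodMk hf
  have h1 : μ.map (fun ω => (X ω, Function.uncurry f (X ω, U ω)))
      = ((μ.map X).prod volume).map fun p => (p.1, Function.uncurry f p) := by
    rw [← hUlaw, ← hXU.map_prod_eq_prod_map_map hX.aemeasurable hU.aemeasurable,
      Measure.map_map hg (hX.prodMk hU)]
    rfl
  have : IsProbabilityMeasure (μ.map X) := Measure.isProbabilityMeasure_map hX.aemeasurable
  ext s hs
  change μ.map (fun ω => (X ω, Function.uncurry f (X ω, U ω))) s = _
  rw [h1, Measure.map_apply hg hs, Measure.prod_apply (hg hs), Measure.compProd_apply hs]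
  refine lintegral_congr fun x => ?_
  rw [← hfκ x, Measure.map_apply hf.of_uncurry_left (measurable_prodMk_left hs)]
  rfl

/-- Almost sure convergence implies, for almost every value of the conditioning variable, weak
convergence of the conditional laws. -/
theorem ae_tendsto_condLaw_comp {Ω E G F : Type*} [MeasurableSpace Ω] [MeasurableSpace E]
    [MeasurableSpace G] [StandardBorelSpace G] [Nonempty G]
    [MeasurableSpace F] [StandardBorelSpace F] [Nonempty F] [TopologicalSpace F]
    [BorelSpace F] {μ : Measure Ω} [IsProbabilityMeasure μ]
    {X : Ω → E} (hX : Measurable X) {Z : Ω → G} (hZ : Measurable Z) {h : ℕ → G → F} {g : G → F}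
    (hh : ∀ n, Measurable (h n)) (hg : Measurable g)
    (hlim : ∀ᵐ z ∂(μ.map Z), Tendsto (fun n => h n z) atTop (𝓝 (g z))) :
    ∀ᵐ x ∂(μ.map X), Tendsto (fun n => condLaw μ (fun ω => h n (Z ω)) X x) atTop
      (𝓝 (condLaw μ (fun ω => g (Z ω)) X x)) := by
  -- The law of `Z` is the mixture of its conditional laws, so a null set for it is null for almost
  -- all of them.
  have h1 : ∀ᵐ x ∂(μ.map X), ∀ᵐ z ∂(condDistrib Z X μ x),
      Tendsto (fun n => h n z) atTop (𝓝 (g z)) := by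
    rw [← condDistrib_comp_map hX.aemeasurable hZ.aemeasurable] at hlim
    exact Measure.ae_ae_of_ae_comp hlim
  have h2 : ∀ᵐ x ∂(μ.map X), ∀ n, condDistrib (fun ω => h n (Z ω)) X μ x
      = (condDistrib Z X μ x).map (h n) := by
    rw [ae_all_iff]
    intro n
    filter_upwards [condDistrib_comp X hZ.aemeasurable (hh n)] with x hx
    rw [← Kernel.map_apply _ (hh n), ← hx]
    rfl
  filter_upwards [h1, h2, condDistrib_comp X hZ.aemeasurable hg] with x hx1 hx2 hx3
  have hx3 : condDistrib (fun ω => g (Z ω)) X μ x = (condDistrib Z X μ x).map g := by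
    rw [← Kernel.map_apply _ hg, ← hx3]
    rfl
  rw [ProbabilityMeasure.tendsto_iff_forall_integral_tendsto]
  intro φ
  simp only [condLaw, ProbabilityMeasure.coe_mk, hx2, hx3]
  have hφ := φ.continuous.measurable
  simp_rw [integral_map (hh _).aemeasurable hφ.aestronglyMeasurable]
  rw [integral_map hg.aemeasurable hφ.aestronglyMeasurable]
  refine tendsto_integral_of_dominated_convergence (fun _ => ‖φ‖)
    (fun n => (hφ.comp (hh n)).aestronglyMeasurable) (integrable_const _)
    (fun n => Eventually.of_forall fun z => φ.norm_coe_le_norm _) ?_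
  filter_upwards [hx1] with z hz
  exact (φ.continuous.tendsto _).comp hz

/-! ### Recovering features and noise from the forecast. -/

theorem measurable_baseForecast {Ω : Type*} [MeasurableSpace Ω] {m : ℕ} {𝒳 : Fin m → Type*}
    [∀ i, MeasurableSpace (𝒳 i)] {X : (i : Fin m) → Ω → 𝒳 i} (hX : ∀ i, Measurable (X i))
    {η : Fin m → Ω → ℝ} (hη : ∀ i, Measurable (η i)) {T : (i : Fin m) → ℝ × 𝒳 i → ℝ}
    (hT : ∀ i, Measurable (T i)) {ysum : Ω → ℝ} (hysum : Measurable ysum) :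
    Measurable (baseForecast ysum T η X) := by
  refine measurable_pi_iff.2 fun i => ?_
  refine Fin.cases hysum (fun j => ?_) i
  exact (hT j).comp ((hη j).prodMk (hX j))

/-- The noise and the features can be recovered from the base forecast. -/
theorem exists_measurable_leftInverse_baseForecast {Ω : Type*} [MeasurableSpace Ω] [Nonempty Ω]
    {m : ℕ} {𝒳 : Fin m → Type*} [∀ i, MeasurableSpace (𝒳 i)] [∀ i, StandardBorelSpace (𝒳 i)]
    (X : (i : Fin m) → Ω → 𝒳 i) (η : Fin m → Ω → ℝ) {T : (i : Fin m) → ℝ × 𝒳 i → ℝ}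
    (hT : ∀ i, Measurable (T i)) (hTinv : ∀ i, Function.Injective (T i)) (ysum : Ω → ℝ) :
    ∃ S : (Fin (m + 1) → ℝ) → (i : Fin m) → ℝ × 𝒳 i, Measurable S ∧
      ∀ ω i, S (baseForecast ysum T η X ω) i = (η i ω, X i ω) := by
  have hne : ∀ i, Nonempty (𝒳 i) := fun i => (inferInstance : Nonempty Ω).map (X i)
  -- This is the Lusin–Souslin theorem.
  have hemb : ∀ i, MeasurableEmbedding (T i) := fun i => (hT i).measurableEmbedding (hTinv i)
  refine ⟨fun y i => (hemb i).invFun (y i.succ), ?_, fun ω i => ?_⟩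
  · exact measurable_pi_iff.2 fun i => (hemb i).measurable_invFun.comp (measurable_pi_apply _)
  · exact (hemb i).leftInverse_invFun _

theorem exists_measurable_condDistrib_comp_baseForecast_eq
    {Ω : Type*} [MeasurableSpace Ω] (μ : Measure Ω) [IsProbabilityMeasure μ] (m : ℕ)
    (𝒳 : Fin m → Type*) [∀ i, MeasurableSpace (𝒳 i)] [∀ i, StandardBorelSpace (𝒳 i)]
    (X : (i : Fin m) → Ω → 𝒳 i) (hX : ∀ i, Measurable (X i)) (Y : Ω → Fin m → ℝ)
    (η : Fin m → Ω → ℝ) (hη : ∀ i, Measurable (η i)) (hηlaw : ∀ i, μ.map (η i) = gaussianReal 0 1)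
    (hηX : IndepFun (fun ω i => η i ω) (fun ω i => X i ω) μ)
    (T : (i : Fin m) → ℝ × 𝒳 i → ℝ) (hT : ∀ i, Measurable (T i))
    (hTinv : ∀ i, Function.Injective (T i)) (ysum : Ω → ℝ) :
    ∃ g : (Fin (m + 1) → ℝ) → (Fin m → ℝ), Measurable g ∧
      condDistrib (fun ω => g (baseForecast ysum T η X ω)) (fun ω i => X i ω) μ
        =ᵐ[μ.map fun ω i => X i ω] condDistrib Y (fun ω i => X i ω) μ := by
  cases m with
  | zero =>
    -- Without sites there is no noise coordinate, but the target is a single point.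
    refine ⟨0, measurable_const, ?_⟩
    have : Y = fun _ => 0 := Subsingleton.elim _ _
    subst this
    exact EventuallyEq.rfl
  | succ m =>
    have : Nonempty Ω := nonempty_of_isProbabilityMeasure μ
    obtain ⟨S, hS, hSinv⟩ := exists_measurable_leftInverse_baseForecast X η hT hTinv ysum
    have : NullSingletonClass (gaussianReal 0 1) := nullSingletonClass_gaussianReal one_ne_zero
    obtain ⟨φ, hφ, hφlaw⟩ := exists_measurable_map_eq_volume_unitInterval (gaussianReal 0 1)
    have hφ0 : Measurable fun e : Fin (m + 1) → ℝ => φ (e 0) := hφ.comp (measurable_pi_apply 0)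
    have hind : IndepFun (fun ω i => X i ω) (fun ω => φ (η 0 ω)) μ :=
      (hηX.comp hφ0 measurable_id).symm
    obtain ⟨f, hf, hfY⟩ := exists_measurable_condDistrib_eq (measurable_pi_iff.2 hX) Y
      (U := fun ω => φ (η 0 ω)) (hφ.comp (hη 0))
      (by rw [← hφlaw, ← hηlaw 0, Measure.map_map hφ (hη 0)]; rfl)
      hind
    refine ⟨fun y => f (fun i => (S y i).2, φ (S y 0).1), ?_, ?_⟩
    · have hSi : ∀ i, Measurable fun y => S y i := measurable_pi_iff.1 hS
      exact hf.comp ((measurable_pi_iff.2 fun i => (hSi i).snd).prodMk (hφ.comp (hSi 0).fst))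
    · simpa only [hSinv] using hfY

theorem tail_structureMatrix_mulVec {m : ℕ} (v : Fin m → ℝ) :
    Fin.tail ((structureMatrix m).mulVec v) = v := by
  ext i
  simp [Fin.tail, structureMatrix, Matrix.mulVec, dotProduct]

theorem condLaw_comp_ae_eq_of_condDistrib_ae_eq {Ω E G F : Type*} [MeasurableSpace Ω]
    [MeasurableSpace E] [MeasurableSpace G] [StandardBorelSpace G] [Nonempty G]
    [MeasurableSpace F] [StandardBorelSpace F] [Nonempty F] {μ : Measure Ω}
    [IsProbabilityMeasure μ] {X : Ω → E} {Y Z : Ω → G} (hY : Measurable Y) (hZ : Measurable Z)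
    {h : G → F} (hh : Measurable h) (heq : condDistrib Z X μ =ᵐ[μ.map X] condDistrib Y X μ) :
    ∀ᵐ x ∂(μ.map X), condLaw μ (fun ω => h (Z ω)) X x = condLaw μ (fun ω => h (Y ω)) X x := by
  filter_upwards [heq, condDistrib_comp X hY.aemeasurable hh,
    condDistrib_comp X hZ.aemeasurable hh] with x hx hxY hxZ
  refine Subtype.ext ?_
  change condDistrib (h ∘ Z) X μ x = condDistrib (h ∘ Y) X μ x
  rw [hxY, hxZ, Kernel.map_apply _ hh, Kernel.map_apply _ hh, hx]

theorem mainTheorem3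
    {Ω : Type*} [MeasurableSpace Ω] (μ : Measure Ω) [IsProbabilityMeasure μ]
    (m : ℕ)
    -- the features of the sites, and the generation at the sites
    (𝒳 : Fin m → Type*) [∀ i, MeasurableSpace (𝒳 i)] [∀ i, StandardBorelSpace (𝒳 i)]
    (X : (i : Fin m) → Ω → 𝒳 i) (hX : ∀ i, Measurable (X i))
    (Y : Ω → Fin m → ℝ) (hY : Measurable Y)
    -- standard Gaussian noise, independent across sites and of the features
    (η : Fin m → Ω → ℝ) (hη : ∀ i, Measurable (η i))
    (hηlaw : ∀ i, μ.map (η i) = gaussianReal 0 1)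
    (hηindep : iIndepFun η μ)
    (hηX : IndepFun (fun ω i => η i ω) (fun ω i => X i ω) μ)
    -- the invertible base generative models, and the base forecast of the aggregate
    (T : (i : Fin m) → ℝ × 𝒳 i → ℝ) (hT : ∀ i, Measurable (T i))
    (hTinv : ∀ i, Function.Injective (T i))
    (ysum : Ω → ℝ) (hysum : Measurable ysum)
    -- the activation function, and the number of hidden layers
    (σ : ℝ → ℝ) (hσ : Continuous σ)
    (hσpoly : ¬ ∃ p : Polynomial ℝ, ∀ x, σ x = p.eval x)
    (L : ℕ) (hL : 1 ≤ L) :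
    ∃ θ : ℕ → NeuralNet L (m + 1) m,
      -- the whole reconciled vector: aggregate and sites
      (∀ᵐ x ∂(μ.map (fun ω i => X i ω)),
        Tendsto
          (fun n => condLaw μ (fun ω => reconcile σ (θ n) (baseForecast ysum T η X ω))
            (fun ω i => X i ω) x)
          atTop
          (𝓝 (condLaw μ (fun ω => (structureMatrix m).mulVec (Y ω)) (fun ω i => X i ω) x))) ∧
      -- the site-level components
      (∀ᵐ x ∂(μ.map (fun ω i => X i ω)),
        Tendsto
          (fun n => condLaw μ
            (fun ω => Fin.tail (reconcile σ (θ n) (baseForecast ysum T η X ω)))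
            (fun ω i => X i ω) x)
          atTop
          (𝓝 (condLaw μ Y (fun ω i => X i ω) x))) := by

  let Z := baseForecast ysum T η X
  have hZ : Measurable Z := measurable_baseForecast hX hη hT hysum
  have hXm : Measurable fun ω i => X i ω := measurable_pi_iff.2 hX
  obtain ⟨g, hg, hgY⟩ := exists_measurable_condDistrib_comp_baseForecast_eq μ m 𝒳 X hX Y η hη
    hηlaw hηX T hT hTinv ysum
  -- Convergence is taken under the law of the whole forecast, so `ysum` may depend on the other
  -- variables in any way.
  obtain ⟨θ, hθ⟩ := NeuralNet.exists_seq_tendsto_ae hσ hσpoly hL (μ.map Z) hg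
  have hcont : ∀ n, Continuous ((θ n).eval σ) := fun n => (θ n).continuous_eval hσ
  have hG : Continuous (structureMatrix m).mulVec := by fun_prop
  refine ⟨θ, ?_, ?_⟩
  · have h1 := ae_tendsto_condLaw_comp hXm hZ (h := fun n => reconcile σ (θ n))
      (g := fun z => (structureMatrix m).mulVec (g z))
      (fun n => (hG.comp (hcont n)).measurable) (hG.measurable.comp hg)
      (hθ.mono fun z hz => (hG.tendsto _).comp hz)
    have h2 := condLaw_comp_ae_eq_of_condDistrib_ae_eq hY (hg.comp hZ) hG.measurable hgY
    filter_upwards [h1, h2] with x hx1 hx2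
    rw [← hx2]
    exact hx1
  · have h1 := ae_tendsto_condLaw_comp hXm hZ (fun n => (hcont n).measurable) hg hθ
    have h2 := condLaw_comp_ae_eq_of_condDistrib_ae_eq hY (hg.comp hZ) measurable_id hgY
    filter_upwards [h1, h2] with x hx1 hx2
    simp only [reconcile, tail_structureMatrix_mulVec]
    simp only [id] at hx2
    rw [← hx2]
    exact hx1
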